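/- **Theorem.** Let $M$ be a connected matroid on a non-empty finite ground set $E$, of rank $r$ (connected means that $M$ is not the direct sum of two matroids on non-empty ground sets). Fix a linear order on $E$. A *broken circuit* is a circuit of $M$ with its least element removed, and the *broken circuit complex* $\Delta^{BC}(M)$ is the simplicial complex of all subsets of $E$ (including $\emptyset$) that contain no broken circuit. For a simplicial complex $\Delta$ of dimension $d-1$ with $f_j(\Delta)$ faces of cardinality $j$, let $$h_i(\Delta)=\sum_{j=0}^{i}(-1)^{i-j}\binom{d-j}{d-i}f_j(\Delta)\qquad(0\le i\le d),$$ and $h_i(\Delta)=0$ for $i>d$. Put $b_i = h_{r-i}(\Delta^{BC}(M))$ for $0\le i\le r$. Then for all integers $i$ with $1\le i\le r$, $$b_i\ \le\ \binom{r-2}{i-1}\,b_1+\binom{r-2}{i-2}.$$ Here $\binom{m}{k}=\frac{m(m-1)\cdots(m-k+1)}{k!}$ for integers $m$ and $k\ge 0$ (so $\binom{m}{0}=1$, also for $m=-1$), and $\binom{m}{k}=0$ for $k<0$. -/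

import Mathlib

namespace BrokenCircuit

/-- A matroid is connected if its ground set is non-empty and it is not the direct sum of two
smaller matroids, that is, of two matroids on disjoint non-empty ground sets. -/
def IsConnected {α : Type*} (M : Matroid α) : Prop :=
  M.E.Nonempty ∧
    ∀ (M₁ M₂ : Matroid α) (h : Disjoint M₁.E M₂.E),
      M₁.E.Nonempty → M₂.E.Nonempty → M ≠ M₁.disjointSum M₂ h

/-- A broken circuit is a circuit with its least element removed. -/
def IsBrokenCircuit {α : Type*} [LinearOrder α] (M : Matroid α) (D : Set α) : Prop :=
  ∃ C e, M.IsCircuit C ∧ IsLeast C e ∧ D = C \ {e}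

/-- The broken circuit complex, given by its set of faces (the empty face included): the finite
subsets of the ground set that contain no broken circuit. -/
def brokenCircuitComplex {α : Type*} [LinearOrder α] (M : Matroid α) : Set (Finset α) :=
  {A | (A : Set α) ⊆ M.E ∧ ∀ D, IsBrokenCircuit M D → ¬ D ⊆ (A : Set α)}

/-- `fNum Δ j` is the number of faces of cardinality `j` of the simplicial complex with set of
faces `Δ` (the empty face included). -/
noncomputable def fNum {α : Type*} (Δ : Set (Finset α)) (j : ℕ) : ℕ :=
  {A | A ∈ Δ ∧ A.card = j}.ncard

/-- The largest cardinality of a face, that is, the dimension of the complex plus one. -/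
noncomputable def dimSucc {α : Type*} (Δ : Set (Finset α)) : ℕ :=
  sSup {k | ∃ A ∈ Δ, A.card = k}

/-- The `i`-th entry of the `h`-vector of the complex with set of faces `Δ`, of dimension `d - 1`:
`h_i = ∑_{j=0}^{i} (-1)^{i-j} * C(d-j, d-i) * f_j` for `0 ≤ i ≤ d`, and `h_i = 0` for `i > d`. -/
noncomputable def hNum {α : Type*} (Δ : Set (Finset α)) (i : ℕ) : ℤ :=
  if i ≤ dimSucc Δ then
    ∑ j ∈ Finset.range (i + 1),
      (-1) ^ (i - j) * ((dimSucc Δ - j).choose (dimSucc Δ - i) : ℤ) * (fNum Δ j : ℤ)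
  else 0

/-- The number `b_i(M)`: the entry `h_{r-i}` of the `h`-vector of the broken circuit complex of `M`,
where `r` is the rank of `M` (and `0` if `i > r`). -/
noncomputable def bNum {α : Type*} [LinearOrder α] (M : Matroid α) (i : ℕ) : ℤ :=
  if i ≤ M.eRank.toNat then hNum (brokenCircuitComplex M) (M.eRank.toNat - i) else 0

/-- The binomial coefficient `C(m, k) = m (m - 1) ⋯ (m - k + 1) / k!` for integers `m` and `k`,
which is `0` if `k < 0`. -/
noncomputable def intBinom (m k : ℤ) : ℤ :=
  if 0 ≤ k then Ring.choose m k.toNat else 0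

end BrokenCircuit

/-! ### Rank functions and the polynomial T(x, 0) -/

namespace BrokenCircuit

open Polynomial

/-! The number b_i is the coefficient of x^i in the Tutte specialization T(x, 0) (`bNum_eq_coeff`).
This follows from Whitney's theorem, `sum_powerset_eq_sum_brokenCircuitComplex`, proved by a
sign-reversing involution. For r ≥ 2 the claim becomes the coefficientwise bound T ≤
x(1+x)^(r-2)(b_1+x).

`RankConnected.tutteX_le` proves this bound by deletion-contraction, inducting on |E|. An element of
a parallel pair can be deleted without changing T. For a series pair f, g, the matroid M/f is
connected, T(M\f) = x T(M\f\g), and M\f\g = (M/f)\g has T at most T(M/f); hence T(M) ≤ (1+x) T(M/f).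
With neither kind of pair, an uncrossing argument (`RankConnected.exists_delete_contract`) finds f
with M\f and M/f both connected. The two bounds then combine because b_1 ≥ 1 for connected matroids
of positive rank. -/

/-- The rank functions of finite matroids, extended to all finite subsets of the ambient type. -/
structure IsRankFn {α : Type*} [DecidableEq α] (ρ : Finset α → ℕ) : Prop where
  empty : ρ ∅ = 0
  mono : ∀ {A B : Finset α}, A ⊆ B → ρ A ≤ ρ B
  insert_le : ∀ (e : α) (A : Finset α), ρ (insert e A) ≤ ρ A + 1
  submod : ∀ A B : Finset α, ρ (A ∩ B) + ρ (A ∪ B) ≤ ρ A + ρ B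

/-- The rank function of the contraction by `e`. -/
def contract {α : Type*} [DecidableEq α] (ρ : Finset α → ℕ) (e : α) (A : Finset α) : ℕ :=
  ρ (insert e A) - ρ {e}

/-- The specialization `T(x, 0)` of the Tutte polynomial of the matroid on `E` with rank
function `ρ`. -/
noncomputable def tutteX {α : Type*} (E : Finset α) (ρ : Finset α → ℕ) : ℤ[X] :=
  -- The sum A.card + ρ A has the parity of the nullity and avoids truncated subtraction.
  ∑ A ∈ E.powerset, (-1) ^ (A.card + ρ A) * (X - 1) ^ (ρ E - ρ A)

/-- All coefficients of the polynomial are nonnegative. -/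
def CoeffNonneg (p : ℤ[X]) : Prop := ∀ n, 0 ≤ p.coeff n

namespace CoeffNonneg

theorem add {p q : ℤ[X]} (hp : CoeffNonneg p) (hq : CoeffNonneg q) : CoeffNonneg (p + q) :=
  fun n => by rw [coeff_add]; exact add_nonneg (hp n) (hq n)

theorem mul {p q : ℤ[X]} (hp : CoeffNonneg p) (hq : CoeffNonneg q) : CoeffNonneg (p * q) :=
  fun n => by
    rw [coeff_mul]
    exact Finset.sum_nonneg fun x _ => mul_nonneg (hp _) (hq _)

theorem zero : CoeffNonneg 0 := fun n => by simp

theorem one : CoeffNonneg 1 := fun n => by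
  rw [coeff_one]; split_ifs <;> norm_num

theorem X : CoeffNonneg X := fun n => by
  rw [coeff_X]; split_ifs <;> norm_num

theorem C {a : ℤ} (ha : 0 ≤ a) : CoeffNonneg (C a) := fun n => by
  rw [coeff_C]; split_ifs <;> simp [ha]

theorem pow {p : ℤ[X]} (hp : CoeffNonneg p) (n : ℕ) : CoeffNonneg (p ^ n) := by
  induction n with
  | zero => simpa using one
  | succ n ih => rw [pow_succ]; exact ih.mul hp

end CoeffNonneg

variable {α : Type*} [DecidableEq α] {E A B : Finset α} {ρ : Finset α → ℕ} {e : α}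

namespace IsRankFn

theorem singleton_le (h : IsRankFn ρ) (e : α) : ρ {e} ≤ 1 := by
  have := h.insert_le e ∅
  rw [h.empty] at this
  simpa using this

/-- Diminishing returns: loops persist over larger sets, coloops over smaller ones. -/
theorem insert_add_le (h : IsRankFn ρ) (e : α) (hAB : A ⊆ B) :
    ρ (insert e B) + ρ A ≤ ρ (insert e A) + ρ B := by
  have h1 := h.submod (insert e A) B
  have h2 : A ⊆ insert e A ∩ B :=
    Finset.subset_inter (Finset.subset_insert _ _) hAB
  have h3 : insert e A ∪ B = insert e B := by
    rw [Finset.insert_union, Finset.union_eq_right.2 hAB]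
  rw [h3] at h1
  have := h.mono h2
  omega

theorem singleton_le_insert (h : IsRankFn ρ) (e : α) (A : Finset α) :
    ρ {e} ≤ ρ (insert e A) :=
  h.mono (by simp)

theorem contract (h : IsRankFn ρ) (e : α) : IsRankFn (contract ρ e) where
  empty := by simp [BrokenCircuit.contract]
  mono := fun hAB => Nat.sub_le_sub_right (h.mono (Finset.insert_subset_insert _ hAB)) _
  insert_le := fun f A => by
    have := h.insert_le f (insert e A)
    rw [Finset.insert_comm] at this
    have := h.singleton_le_insert e A
    unfold BrokenCircuit.contract
    omega
  submod := fun A B => by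
    have := h.submod (insert e A) (insert e B)
    rw [← Finset.insert_inter_distrib, ← Finset.insert_union_distrib] at this
    have h1 := h.singleton_le_insert e A
    have h2 := h.singleton_le_insert e B
    have h3 := h.singleton_le_insert e (A ∩ B)
    have h4 := h.singleton_le_insert e (A ∪ B)
    unfold BrokenCircuit.contract
    omega

end IsRankFn

theorem tutteX_congr {α : Type*} {E : Finset α} {ρ ρ' : Finset α → ℕ} (h : ∀ A ⊆ E, ρ A = ρ' A) :
    tutteX E ρ = tutteX E ρ' := by
  refine Finset.sum_congr rfl fun A hA => ?_
  rw [h A (Finset.mem_powerset.1 hA), h E subset_rfl]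

theorem tutteX_empty (h : IsRankFn ρ) : tutteX ∅ ρ = 1 := by
  simp [tutteX, h.empty]

theorem tutteX_insert_loop (h : IsRankFn ρ) (he : e ∉ E) (hl : ρ {e} = 0) :
    tutteX (insert e E) ρ = 0 := by
  unfold tutteX
  rw [Finset.sum_powerset_insert he, ← Finset.sum_add_distrib]
  refine Finset.sum_eq_zero fun A hA => ?_
  have heA : e ∉ A := fun h' => he (Finset.mem_powerset.1 hA h')
  have h1 : ρ (insert e A) = ρ A := by
    have h1 := h.insert_add_le e (Finset.empty_subset A)
    have h2 := h.mono (Finset.subset_insert e A)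
    rw [h.empty, insert_empty_eq] at h1
    omega
  rw [h1, Finset.card_insert_of_notMem heA]
  ring

theorem tutteX_insert_coloop (h : IsRankFn ρ) (he : e ∉ E) (hl : ρ (insert e E) = ρ E + 1) :
    tutteX (insert e E) ρ = X * tutteX E ρ := by
  unfold tutteX
  rw [Finset.sum_powerset_insert he, ← Finset.sum_add_distrib, Finset.mul_sum]
  refine Finset.sum_congr rfl fun A hA => ?_
  have hAE := Finset.mem_powerset.1 hA
  have heA : e ∉ A := fun h' => he (hAE h')
  have h1 : ρ (insert e A) = ρ A + 1 := by
    have h1 := h.insert_add_le e hAE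
    have h2 := h.insert_le e A
    omega
  have h2 := h.mono hAE
  have h3 : ρ E + 1 - ρ A = (ρ E - ρ A) + 1 := by omega
  rw [h1, hl, h3, Finset.card_insert_of_notMem heA, Nat.add_sub_add_right]
  ring

theorem tutteX_insert (h : IsRankFn ρ) (he : e ∉ E) (hl : ρ {e} = 1)
    (hc : ρ (insert e E) = ρ E) :
    tutteX (insert e E) ρ = tutteX E ρ + tutteX E (contract ρ e) := by
  unfold tutteX
  rw [Finset.sum_powerset_insert he, hc]
  congr 1
  refine Finset.sum_congr rfl fun A hA => ?_
  have hAE := Finset.mem_powerset.1 hA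
  have heA : e ∉ A := fun h' => he (hAE h')
  have h1 := h.singleton_le_insert e A
  rw [hl] at h1
  obtain ⟨k, hk⟩ : ∃ k, ρ (insert e A) = k + 1 := ⟨ρ (insert e A) - 1, by omega⟩
  unfold contract
  rw [hl, hc, hk, Finset.card_insert_of_notMem heA, Nat.add_sub_cancel,
    show ρ E - 1 - k = ρ E - (k + 1) by omega]
  ring

/-- Deletion-contraction has no negative term. Connectedness plays no role, so this also covers the
possibly disconnected minors of the series case. -/
theorem coeffNonneg_tutteX (h : IsRankFn ρ) : CoeffNonneg (tutteX E ρ) := by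
  induction E using Finset.induction_on generalizing ρ with
  | empty => rw [tutteX_empty h]; exact .one
  | insert e E he ih =>
    have h1 := h.singleton_le e
    have h2 := h.insert_le e E
    have h3 := h.mono (Finset.subset_insert e E)
    rcases Nat.eq_zero_or_pos (ρ {e}) with h4 | h4
    · rw [tutteX_insert_loop h he h4]; exact .zero
    · rcases Nat.lt_or_ge (ρ E) (ρ (insert e E)) with h5 | h5
      · rw [tutteX_insert_coloop h he (by omega)]
        exact .mul .X (ih h)
      · rw [tutteX_insert h he (by omega) (by omega)]
        exact .add (ih h) (ih (h.contract e))

/-- Connectedness of the matroid on `E` with rank function `ρ`. -/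
def RankConnected (E : Finset α) (ρ : Finset α → ℕ) : Prop :=
  E.Nonempty ∧ ∀ A B : Finset α, A.Nonempty → B.Nonempty → Disjoint A B → A ∪ B = E →
    ρ E < ρ A + ρ B

end BrokenCircuit

/-! ### Uncrossing: an element with connected deletion and contraction -/

namespace BrokenCircuit

open Polynomial

variable {α : Type*} [DecidableEq α] {E A B : Finset α} {ρ : Finset α → ℕ} {e : α}

/-- Let `l` be a symmetric submodular function on subsets of `E`, at least `c` on proper non-empty
subsets and larger than `c` on pairs. Then some element of `E` lies on the boundary of no set `A`
for which both `A` and `insert f A` have value at most `c`. -/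
theorem exists_forall_not_le_of_submodular {l : Finset α → ℕ} {c : ℕ} (hE : E.Nonempty)
    (hsub : ∀ A B, l (A ∩ B) + l (A ∪ B) ≤ l A + l B)
    (hsymm : ∀ A ⊆ E, l (E \ A) = l A)
    (hlow : ∀ A ⊆ E, A.Nonempty → A ≠ E → c ≤ l A)
    (hpair : ∀ f ∈ E, ∀ g ∈ E, f ≠ g → c < l {f, g}) :
    ∃ f ∈ E, ∀ A ⊆ E, f ∉ A → A.Nonempty → insert f A ≠ E → ¬ (l A ≤ c ∧ l (insert f A) ≤ c) := by
  by_contra! hcon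
  -- Descent on the size of A. The condition `insert f A ≠ E` is needed only for sets taken from
  -- `hcon`, to make a complement non-empty.
  suffices H : ∀ (n : ℕ) (f : α) (A : Finset α), A.card = n → f ∈ E → A ⊆ E → f ∉ A →
      A.Nonempty → l A ≤ c → l (insert f A) ≤ c → False by
    obtain ⟨f, hf⟩ := hE
    obtain ⟨A, hAE, hfA, hA, -, h1, h2⟩ := hcon f hf
    exact H _ f A rfl hf hAE hfA hA h1 h2
  intro n
  induction n using Nat.strong_induction_on with | _ n ih => ?_
  intro f A hn hf hAE hfA hA hA1 hA2
  obtain ⟨g, hg⟩ := hA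
  have hgE := hAE hg
  have hfg : f ≠ g := fun h => hfA (h ▸ hg)
  by_cases hAg : A = {g}
  · subst hAg
    exact absurd hA2 (not_le.2 (hpair f hf g hgE hfg))
  have hne : (A.erase g).Nonempty := by
    rw [Finset.erase_nonempty hg]
    exact (Finset.nontrivial_iff_ne_singleton hg).2 hAg
  obtain ⟨D, hDE, hgD, hD, hfD, hD1, hD2⟩ : ∃ D ⊆ E, g ∉ D ∧ D.Nonempty ∧ f ∉ D ∧ l D ≤ c ∧
      l (insert g D) ≤ c := by
    obtain ⟨D, hDE, hgD, hD, hDne, hD1, hD2⟩ := hcon g hgE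
    -- By symmetry of `l`, complementing D and `insert g D` gives another bad pair for g, so f may
    -- be assumed outside D. This keeps A ∪ D proper.
    by_cases hfD : f ∈ D
    · have hsub1 : insert g D ⊆ E := Finset.insert_subset hgE hDE
      refine ⟨E \ insert g D, Finset.sdiff_subset, by simp, ?_, by simp [hfD], ?_, ?_⟩
      · rw [Finset.sdiff_nonempty]
        exact fun h => hDne (subset_antisymm hsub1 h)
      · rwa [hsymm _ hsub1]
      · have : insert g (E \ insert g D) = E \ D := by clear * - hgD hDE hgE; grind
        rwa [this, hsymm _ hDE]
    · exact ⟨D, hDE, hgD, hD, hfD, hD1, hD2⟩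
  have hcard : ∀ A' ⊆ A.erase g, A'.card < n := fun A' h => by
    have := Finset.card_le_card h
    have := Finset.card_erase_lt_of_mem hg
    omega
  have hun : c ≤ l (A ∪ D) :=
    hlow _ (Finset.union_subset hAE hDE) ⟨g, by simp [hg]⟩
      (by clear * - hf hfA hfD; grind)
  -- Otherwise uncrossing A with D and with `insert g D` makes (g, A ∩ D) a smaller bad pair.
  have hAD : A ∩ D = ∅ := by
    by_contra hne'
    have h1 := hsub A D
    have h2 := hsub A (insert g D)
    have e1 : A ∩ insert g D = insert g (A ∩ D) := by clear * - hg; grind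
    have e2 : A ∪ insert g D = A ∪ D := by clear * - hg; grind
    rw [e1, e2] at h2
    exact ih _ (hcard (A ∩ D) (by clear * - hgD; grind)) g (A ∩ D) rfl hgE
      (Finset.inter_subset_left.trans hAE) (by simp [hgD])
      (Finset.nonempty_iff_ne_empty.2 hne') (by omega) (by omega)
  have hsub1 : insert g D ⊆ E := Finset.insert_subset hgE hDE
  -- With A and D disjoint, uncross A and `insert f A` with the complement of `insert g D`. Both
  -- unions are E \ D, where `l` is at least c, so (f, A \ g) is a smaller bad pair.
  have h1 := hsub A (E \ insert g D)
  have h2 := hsub (insert f A) (E \ insert g D)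
  have hdisj : ∀ x ∈ A, x ∉ D := Finset.disjoint_left.1 (Finset.disjoint_iff_inter_eq_empty.2 hAD)
  have e1 : A ∩ (E \ insert g D) = A.erase g := by
    clear * - hdisj hAE hg
    grind
  have e2 : A ∪ (E \ insert g D) = E \ D := by
    clear * - hdisj hAE hg
    grind
  have e3 : insert f A ∩ (E \ insert g D) = insert f (A.erase g) := by
    rw [Finset.insert_inter_of_mem (by simp [hf, hfg, hfD]), e1]
  have e4 : insert f A ∪ (E \ insert g D) = E \ D := by
    rw [Finset.insert_union, e2, Finset.insert_eq_of_mem (by simp [hf, hfD])]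
  rw [e1, e2, hsymm _ hsub1, hsymm _ hDE] at h1
  rw [e3, e4, hsymm _ hsub1, hsymm _ hDE] at h2
  have hlD := hlow D hDE hD (fun h => hfD (h ▸ hf))
  exact ih _ (hcard _ subset_rfl) f (A.erase g) rfl hf ((Finset.erase_subset _ _).trans hAE)
    (by simp [hfA]) hne (by omega) (by omega)

/-- The partition of E into e and the rest shows that e is neither a loop nor a coloop. -/
theorem RankConnected.rank_singleton (h : IsRankFn ρ) (hE : RankConnected E ρ)
    (hcard : 2 ≤ E.card) (he : e ∈ E) : ρ {e} = 1 ∧ ρ (E.erase e) = ρ E := by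
  have h1 := hE.2 {e} (E.erase e) (by simp)
    (by rw [← Finset.card_pos, Finset.card_erase_of_mem he]; omega)
    (by simp) (by simp [he])
  have h2 := h.singleton_le e
  have h3 := h.mono (Finset.erase_subset e E)
  omega

/-- A connected matroid without series pairs and parallel pairs has an element whose deletion and
contraction are both connected. -/
theorem RankConnected.exists_delete_contract (h : IsRankFn ρ) (hE : RankConnected E ρ)
    (hcard : 2 ≤ E.card)
    (hpair : ∀ f ∈ E, ∀ g ∈ E, f ≠ g → ρ E + 1 < ρ {f, g} + ρ (E \ {f, g})) :
    ∃ f ∈ E, RankConnected (E.erase f) ρ ∧ RankConnected (E.erase f) (contract ρ f) := by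
  obtain ⟨f, hf, hfA⟩ := exists_forall_not_le_of_submodular (l := fun A => ρ A + ρ (E \ A))
    (c := ρ E + 1) hE.1
    (fun A B => by
      have h1 := h.submod A B
      have h2 := h.submod (E \ A) (E \ B)
      have e1 : (E \ A) ∩ (E \ B) = E \ (A ∪ B) := by clear * -; grind
      have e2 : (E \ A) ∪ (E \ B) = E \ (A ∩ B) := by clear * -; grind
      rw [e1, e2] at h2
      omega)
    (fun A hA => by
      rw [Finset.sdiff_sdiff_eq_self hA, add_comm])
    (fun A hA hne hne' => hE.2 A (E \ A) hne
      (Finset.sdiff_nonempty.2 fun h' => hne' (subset_antisymm hA h'))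
      Finset.disjoint_sdiff (Finset.union_sdiff_of_subset hA))
    hpair
  have hne : (E.erase f).Nonempty := by
    rw [← Finset.card_pos, Finset.card_erase_of_mem hf]
    omega
  -- A separation of M\f or of M/f would have connectivity value at most ρ E + 1 whichever side f
  -- joins; the choice of f forbids that.
  have key : ∀ A B : Finset α, A.Nonempty → B.Nonempty → Disjoint A B → A ∪ B = E.erase f →
      ¬ (ρ A + ρ (insert f B) ≤ ρ E + 1 ∧ ρ (insert f A) + ρ B ≤ ρ E + 1) := by
    intro A B hA hB hAB hABE
    have hfe : f ∉ A ∪ B := by rw [hABE]; simp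
    have hEf : insert f (A ∪ B) = E := by rw [hABE, Finset.insert_erase hf]
    rw [Finset.disjoint_left] at hAB
    have := hfA A (by clear * - hEf; grind) (by clear * - hfe; grind) hA (by
      obtain ⟨b, hb⟩ := hB
      intro h'
      have : b ∈ insert f A := by rw [h', ← hEf]; simp [hb]
      clear * - hfe hAB hb this
      grind)
    have e1 : E \ A = insert f B := by clear * - hEf hAB hfe; grind
    have e2 : E \ insert f A = B := by clear * - hEf hAB hfe; grind
    simpa only [e1, e2] using this
  refine ⟨f, hf, ⟨hne, fun A B hA hB hAB hABE => ?_⟩, ⟨hne, fun A B hA hB hAB hABE => ?_⟩⟩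
  · have h1 := key A B hA hB hAB hABE
    have h2 := h.insert_le f A
    have h3 := h.insert_le f B
    have h4 := h.mono (Finset.erase_subset f E)
    omega
  · have h1 := key A B hA hB hAB hABE
    have h2 := h.mono (Finset.subset_insert f A)
    have h3 := h.mono (Finset.subset_insert f B)
    have h4 := h.singleton_le_insert f A
    have h5 := h.singleton_le_insert f B
    have h6 := (hE.rank_singleton h hcard hf).1
    have h7 := h.mono (Finset.singleton_subset_iff.2 hf)
    unfold contract
    rw [Finset.insert_erase hf]
    omega

end BrokenCircuit

/-! ### Deletion-contraction and the coefficientwise bound -/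

namespace BrokenCircuit

open Polynomial

variable {α : Type*} [DecidableEq α] {E A B : Finset α} {ρ : Finset α → ℕ} {e f g : α}

theorem tutteX_eq_add (h : IsRankFn ρ) (he : e ∈ E) (hl : ρ {e} = 1)
    (hc : ρ (E.erase e) = ρ E) :
    tutteX E ρ = tutteX (E.erase e) ρ + tutteX (E.erase e) (contract ρ e) := by
  conv_lhs => rw [← Finset.insert_erase he]
  exact tutteX_insert h (Finset.notMem_erase e E) hl (by rw [Finset.insert_erase he, hc])

theorem tutteX_eq_zero (h : IsRankFn ρ) (he : e ∈ E) (hl : ρ {e} = 0) : tutteX E ρ = 0 := by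
  rw [← Finset.insert_erase he]
  exact tutteX_insert_loop h (Finset.notMem_erase e E) hl

theorem tutteX_eq_X_mul (h : IsRankFn ρ) (he : e ∈ E) (hl : ρ E = ρ (E.erase e) + 1) :
    tutteX E ρ = X * tutteX (E.erase e) ρ := by
  conv_lhs => rw [← Finset.insert_erase he]
  exact tutteX_insert_coloop h (Finset.notMem_erase e E) (by rw [Finset.insert_erase he, hl])

theorem tutteX_singleton (h : IsRankFn ρ) (he : ρ {e} = 1) : tutteX {e} ρ = X := by
  rw [tutteX_eq_X_mul h (Finset.mem_singleton_self e) (by simp [he, h.empty])]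
  simp [tutteX_empty h]

/-- By symmetry, g, later the partner of f in its pair, may be put in B. -/
theorem RankConnected.of_partition {S : Finset α} {σ : Finset α → ℕ} (hS : S.Nonempty) (g : α)
    (H : ∀ A B : Finset α, A.Nonempty → g ∈ B → Disjoint A B → A ∪ B = S → σ S < σ A + σ B)
    (hg : g ∈ S) : RankConnected S σ := by
  refine ⟨hS, fun A B hA hB hAB hABS => ?_⟩
  rw [← hABS, Finset.mem_union] at hg
  rcases hg with hg | hg
  · rw [add_comm]
    exact H B A hB hg hAB.symm (by rw [Finset.union_comm, hABS])
  · exact H A B hA hg hAB hABS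

theorem RankConnected.rank_lt_insert (hE : RankConnected E ρ) (hf : f ∈ E) (hA : A.Nonempty)
    (hAB : Disjoint A B) (hABE : A ∪ B = E.erase f) : ρ E < ρ A + ρ (insert f B) := by
  have hfA : f ∉ A := fun h => by
    have : f ∈ E.erase f := hABE ▸ Finset.mem_union_left B h
    simp at this
  refine hE.2 A (insert f B) hA (Finset.insert_nonempty f B) ?_ ?_
  · rw [Finset.disjoint_insert_right]
    exact ⟨hfA, hAB⟩
  · rw [Finset.union_insert, hABE, Finset.insert_erase hf]

/-- Deleting an element of a parallel pair preserves connectedness. -/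
theorem RankConnected.erase_of_parallel (h : IsRankFn ρ) (hE : RankConnected E ρ) (hf : f ∈ E)
    (hg : g ∈ E.erase f) (hg1 : ρ {g} = 1) (hc : ρ (E.erase f) = ρ E) (hfg : ρ {f, g} ≤ 1) :
    RankConnected (E.erase f) ρ := by
  refine .of_partition ⟨g, hg⟩ g (fun A B hA hgB hAB hABE => ?_) hg
  have h1 := hE.rank_lt_insert hf hA hAB hABE
  have h2 := h.insert_add_le f (Finset.singleton_subset_iff.2 hgB)
  omega

/-- Contracting an element of a series pair preserves connectedness. -/
theorem RankConnected.contract_of_series (h : IsRankFn ρ) (hE : RankConnected E ρ) (hf : f ∈ E)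
    (hg : g ∈ E.erase f) (hf1 : ρ {f} = 1)
    (hcg : ρ (E.erase g) = ρ E) (hfg : ρ ((E.erase f).erase g) + 1 = ρ E) :
    RankConnected (E.erase f) (contract ρ f) := by
  refine .of_partition ⟨g, hg⟩ g (fun A B hA hgB hAB hABE => ?_) hg
  have h1 := hE.rank_lt_insert hf hA hAB hABE
  have hAE : A ⊆ (E.erase f).erase g := by
    refine Finset.subset_erase.2 ⟨hABE ▸ Finset.subset_union_left, fun hgA => ?_⟩
    exact Finset.disjoint_left.1 hAB hgA hgB
  -- f is a coloop over E \ {f, g}, hence over A, so contracting f does not lower the rank of A.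
  have h2 := h.insert_add_le f hAE
  rw [Finset.erase_right_comm, Finset.insert_erase (by simp_all [eq_comm]), hcg,
    Finset.erase_right_comm] at h2
  have h3 := h.mono (Finset.singleton_subset_iff.2 hf)
  have h4 := h.singleton_le_insert f A
  have h5 := h.singleton_le_insert f B
  unfold contract
  rw [Finset.insert_erase hf]
  omega

/-- In a series pair `f, g` of a connected matroid, the part of the deletion-contraction recursion
coming from the deletion of `f` is at most `X` times the part coming from the contraction. -/
theorem RankConnected.exists_tutteX_of_series (h : IsRankFn ρ) (hE : RankConnected E ρ)
    (hcard : 2 ≤ E.card) (hf : f ∈ E) (hg : g ∈ E.erase f) (hfg2 : ρ {f, g} = 2)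
    (hfg : ρ ((E.erase f).erase g) + 1 = ρ E) :
    ∃ q : ℤ[X], CoeffNonneg q ∧ CoeffNonneg (tutteX (E.erase f) (contract ρ f) - q) ∧
      tutteX E ρ = X * q + tutteX (E.erase f) (contract ρ f) := by
  have hgE := Finset.mem_of_mem_erase hg
  obtain ⟨hf1, hcf⟩ := hE.rank_singleton h hcard hf
  obtain ⟨hg1, hcg⟩ := hE.rank_singleton h hcard hgE
  have hfge : f ∈ E.erase g := Finset.mem_erase.2 ⟨(Finset.ne_of_mem_erase hg).symm, hf⟩
  -- f is a coloop of M\g, so deleting and contracting f agree there.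
  have hcontr : tutteX ((E.erase f).erase g) ρ = tutteX ((E.erase f).erase g) (contract ρ f) := by
    refine tutteX_congr fun A hA => ?_
    have h1 := h.insert_add_le f hA
    rw [Finset.erase_right_comm, Finset.insert_erase hfge, hcg, Finset.erase_right_comm] at h1
    have h2 := h.insert_le f A
    unfold contract
    omega
  refine ⟨tutteX ((E.erase f).erase g) ρ, coeffNonneg_tutteX h, ?_, ?_⟩
  · rw [tutteX_eq_add (h.contract f) hg, hcontr, add_sub_cancel_left]
    · exact coeffNonneg_tutteX ((h.contract f).contract g)
    · simp [contract, hfg2, hf1]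
    · unfold contract
      rw [Finset.erase_right_comm, Finset.insert_erase hfge, Finset.insert_erase hf, hcg]
  · rw [tutteX_eq_add h hf hf1 hcf, tutteX_eq_X_mul h hg (by omega)]

/-- The upper bound for `T(x, 0)` of a connected matroid of positive rank. -/
theorem RankConnected.tutteX_le (n : ℕ) : ∀ (E : Finset α) (ρ : Finset α → ℕ), E.card = n →
    IsRankFn ρ → RankConnected E ρ → 1 ≤ ρ E →
    1 ≤ (tutteX E ρ).coeff 1 ∧ (ρ E = 1 → tutteX E ρ = X) ∧
      ∀ r, ρ E = r + 2 →
        CoeffNonneg (X * (1 + X) ^ r * (C ((tutteX E ρ).coeff 1) + X) - tutteX E ρ) := by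
  -- The lower bound on the linear coefficient is used when the deletion and contraction bounds are
  -- combined. Rank 1 is separate because the exponent r - 2 would be negative.
  induction n using Nat.strong_induction_on with | _ n ih => ?_
  intro E ρ hn h hE hpos
  have hone : CoeffNonneg (1 + X) := .add .one .X
  rcases Nat.lt_or_ge E.card 2 with hcard | hcard
  · obtain ⟨e, rfl⟩ : ∃ e, E = {e} := by
      rw [← Finset.card_eq_one]
      have := hE.1.card_pos
      omega
    have h1 := h.singleton_le e
    rw [tutteX_singleton h (by omega)]
    refine ⟨by simp, fun _ => rfl, fun r hr => by omega⟩
  have hlt : ∀ f ∈ E, (E.erase f).card < n := fun f hf => hn ▸ Finset.card_erase_lt_of_mem hf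
  by_cases hpar : ∃ f ∈ E, ∃ g ∈ E.erase f, ρ {f, g} ≤ 1
  · obtain ⟨f, hf, g, hg, hfg⟩ := hpar
    obtain ⟨hf1, hcf⟩ := hE.rank_singleton h hcard hf
    obtain ⟨hg1, -⟩ := hE.rank_singleton h hcard (Finset.mem_of_mem_erase hg)
    have h1 : tutteX E ρ = tutteX (E.erase f) ρ := by
      rw [tutteX_eq_add h hf hf1 hcf, tutteX_eq_zero (h.contract f) hg, add_zero]
      simp only [contract]
      omega
    rw [h1, ← hcf]
    exact ih _ (hlt f hf) _ _ rfl h (hE.erase_of_parallel h hf hg hg1 hcf hfg) (by omega)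
  push Not at hpar
  have hrank : 2 ≤ ρ E := by
    obtain ⟨f, hf⟩ := hE.1
    obtain ⟨g, hg⟩ : (E.erase f).Nonempty := by
      rw [← Finset.card_pos, Finset.card_erase_of_mem hf]
      omega
    have h1 := hpar f hf g hg
    have h2 : ρ {f, g} ≤ ρ E := h.mono (by
      simp [Finset.insert_subset_iff, hf, Finset.mem_of_mem_erase hg])
    omega
  by_cases hser : ∃ f ∈ E, ∃ g ∈ E.erase f, ρ {f, g} + ρ ((E.erase f).erase g) ≤ ρ E + 1
  · obtain ⟨f, hf, g, hg, hfg⟩ := hser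
    obtain ⟨hf1, hcf⟩ := hE.rank_singleton h hcard hf
    obtain ⟨-, hcg⟩ := hE.rank_singleton h hcard (Finset.mem_of_mem_erase hg)
    have hp := hpar f hf g hg
    have h1 := h.insert_le f {g}
    have h2 := h.singleton_le g
    have h3 := h.insert_le g ((E.erase f).erase g)
    rw [Finset.insert_erase hg] at h3
    obtain ⟨q, hq, hqb, hT⟩ := hE.exists_tutteX_of_series h hcard hf hg (by omega) (by omega)
    have hrk : contract ρ f (E.erase f) + 1 = ρ E := by
      unfold contract
      rw [Finset.insert_erase hf]
      omega
    obtain ⟨hb1, hb2, hb3⟩ := ih _ (hlt f hf) _ _ rfl (h.contract f)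
      (hE.contract_of_series h hf hg hf1 hcg (by omega)) (by omega)
    have hco : (tutteX E ρ).coeff 1 = q.coeff 0 + (tutteX (E.erase f) (contract ρ f)).coeff 1 := by
      rw [hT, coeff_add, coeff_X_mul]
    have hq0 := hq 0
    refine ⟨by omega, by omega, fun r hr => ?_⟩
    rcases r with _ | r
    · have hb := hb2 (by omega)
      have hid : X * (1 + X) ^ 0 * (C ((tutteX E ρ).coeff 1) + X) - tutteX E ρ
          = X * (tutteX (E.erase f) (contract ρ f) - q)
            + X * C ((tutteX E ρ).coeff 1 - 1) := by
        rw [hT, hb]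
        simp only [C_sub, C_1]
        ring
      rw [hid]
      exact .add (.mul .X hqb) (.mul .X (.C (by omega)))
    · have hb := hb3 r (by omega)
      set b := tutteX (E.erase f) (contract ρ f)
      -- Since q ≤ b, T = Xq + b is at most (1 + X)b, and the factor 1 + X makes up for the lower
      -- rank of b. The linear coefficient grows by q(0) ≥ 0.
      have hid : X * (1 + X) ^ (r + 1) * (C ((tutteX E ρ).coeff 1) + X) - tutteX E ρ
          = X * (1 + X) ^ (r + 1) * C ((tutteX E ρ).coeff 1 - b.coeff 1) + X * (b - q)
            + (1 + X) * (X * (1 + X) ^ r * (C (b.coeff 1) + X) - b) := by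
        generalize (tutteX E ρ).coeff 1 = β
        rw [hT, C_sub]
        ring
      rw [hid]
      exact .add (.add (.mul (.mul .X (hone.pow _)) (.C (by omega))) (.mul .X hqb)) (.mul hone hb)
  push Not at hser
  obtain ⟨f, hf, hdel, hcon⟩ := hE.exists_delete_contract h hcard (fun f hf g hg hne => by
    have := hser f hf g (Finset.mem_erase.2 ⟨hne.symm, hg⟩)
    rwa [show E \ {f, g} = (E.erase f).erase g by clear * -; grind])
  obtain ⟨hf1, hcf⟩ := hE.rank_singleton h hcard hf
  have hrk : contract ρ f (E.erase f) + 1 = ρ E := by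
    unfold contract
    rw [Finset.insert_erase hf]
    omega
  obtain ⟨ha1, -, ha3⟩ := ih _ (hlt f hf) _ _ rfl h hdel (by omega)
  obtain ⟨hb1, hb2, hb3⟩ := ih _ (hlt f hf) _ _ rfl (h.contract f) hcon (by omega)
  have hT := tutteX_eq_add h hf hf1 hcf
  set a := tutteX (E.erase f) ρ
  set b := tutteX (E.erase f) (contract ρ f)
  rw [hT, coeff_add]
  refine ⟨by omega, by omega, fun r hr => ?_⟩
  have ha := ha3 r (by omega)
  rcases r with _ | r
  · have hid : X * (1 + X) ^ 0 * (C (a.coeff 1 + b.coeff 1) + X) - (a + b)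
        = X * (1 + X) ^ 0 * (C (a.coeff 1) + X) - a := by
      rw [hb2 (by omega)]
      simp only [coeff_X_one, C_add, C_1]
      ring
    rwa [hid]
  · have hb := hb3 r (by omega)
    -- The bound for b has one factor 1 + X fewer. With b₁ its linear coefficient, (1 + X)b₁ - (b₁ +
    -- X) = X(b₁ - 1), nonnegative because b₁ ≥ 1.
    have hid : X * (1 + X) ^ (r + 1) * (C (a.coeff 1 + b.coeff 1) + X) - (a + b)
        = (X * (1 + X) ^ (r + 1) * (C (a.coeff 1) + X) - a)
          + (X * (1 + X) ^ r * (C (b.coeff 1) + X) - b)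
          + X * (1 + X) ^ r * (X * C (b.coeff 1 - 1)) := by
      simp only [C_add, C_sub, C_1]
      ring
    rw [hid]
    exact .add (.add ha hb) (.mul (.mul .X (hone.pow _)) (.mul .X (.C (by omega))))

end BrokenCircuit

/-! ### From matroids to rank functions -/

namespace BrokenCircuit

open Polynomial

section Rank

variable {α : Type*} [DecidableEq α] (M : Matroid α)

/-- The rank function of a matroid as a natural-number valued function on finite sets. -/
noncomputable def finRk {α : Type*} (M : Matroid α) (A : Finset α) : ℕ := (M.eRk A).toNat

theorem coe_finRk {α : Type*} (M : Matroid α) (A : Finset α) : (finRk M A : ℕ∞) = M.eRk A :=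
  ENat.natCast_toNat (M.isRkFinite_of_finite A.finite_toSet).eRk_lt_top.ne

theorem isRankFn_finRk : IsRankFn (finRk M) where
  empty := by simp [finRk]
  mono := fun {A B} hAB => by
    have := M.eRk_mono (Finset.coe_subset.2 hAB)
    rw [← coe_finRk, ← coe_finRk] at this
    exact_mod_cast this
  insert_le := fun e A => by
    have := M.eRk_insert_le_add_one e (A : Set α)
    rw [← Finset.coe_insert, ← coe_finRk, ← coe_finRk] at this
    exact_mod_cast this
  submod := fun A B => by
    have := M.eRk_inter_add_eRk_union_le (A : Set α) (B : Set α)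
    rw [← Finset.coe_inter, ← Finset.coe_union, ← coe_finRk, ← coe_finRk, ← coe_finRk,
      ← coe_finRk] at this
    exact_mod_cast this

/-- Bases of A and B extending I ∩ A and I ∩ B have a spanning union of at most `M.eRank` elements,
which is therefore independent. -/
theorem eq_disjointSum_of_eRk_le {α : Type*} {M : Matroid α} [M.RankFinite] {A B : Set α}
    (hAB : Disjoint (M.restrict A).E (M.restrict B).E) (hE : A ∪ B = M.E) (hr : M.eRk A + M.eRk B ≤ M.eRank) :
    M = (M.restrict A).disjointSum (M.restrict B) hAB := by
  refine Matroid.ext_indep (by simp [hE]) fun I hI => ?_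
  have hA : A ⊆ M.E := hE ▸ Set.subset_union_left
  have hB : B ⊆ M.E := hE ▸ Set.subset_union_right
  simp only [Matroid.disjointSum_indep_iff, Matroid.restrict_ground_eq, Matroid.restrict_indep_iff]
  refine ⟨fun h => ⟨⟨h.subset Set.inter_subset_left, Set.inter_subset_right⟩,
    ⟨h.subset Set.inter_subset_left, Set.inter_subset_right⟩, hE ▸ hI⟩, ?_⟩
  rintro ⟨⟨hIA, -⟩, ⟨hIB, -⟩, -⟩
  obtain ⟨J, hJ, hIJ⟩ := hIA.subset_isBasis_of_subset Set.inter_subset_right hA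
  obtain ⟨K, hK, hIK⟩ := hIB.subset_isBasis_of_subset Set.inter_subset_right hB
  refine Matroid.Indep.subset (J := J ∪ K) ?_ ?_
  · refine (M.isRkFinite_set _).indep_of_encard_le_eRk ?_
    calc (J ∪ K).encard ≤ J.encard + K.encard := Set.encard_union_le J K
      _ = M.eRk A + M.eRk B := by rw [hJ.encard_eq_eRk, hK.encard_eq_eRk]
      _ ≤ M.eRank := hr
      _ = M.eRk (M.closure (J ∪ K)) := by
        rw [M.eRk_eq_eRank]
        rw [← hE]
        exact Set.union_subset
          (hJ.subset_closure.trans (M.closure_subset_closure Set.subset_union_left))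
          (hK.subset_closure.trans (M.closure_subset_closure Set.subset_union_right))
      _ = M.eRk (J ∪ K) := M.eRk_closure_eq _
  · exact fun x hx => (hE.ge (hI hx)).imp (fun h => hIJ ⟨hx, h⟩) (fun h => hIK ⟨hx, h⟩)

theorem IsConnected.rankConnected {M : Matroid α} [M.Finite] (hM : IsConnected M) :
    RankConnected M.ground_finite.toFinset (finRk M) := by
  refine ⟨by simpa using hM.1, fun A B hA hB hAB hABE => ?_⟩
  by_contra! hcon
  have hABE' : (A : Set α) ∪ B = M.E := by rw [← Finset.coe_union, hABE]; simp
  refine hM.2 (M.restrict A) (M.restrict B) (Finset.disjoint_coe.2 hAB) (by simpa using hA) (by simpa using hB)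
    (eq_disjointSum_of_eRk_le (Finset.disjoint_coe.2 hAB) hABE' ?_)
  rw [← coe_finRk, ← coe_finRk, ← M.eRk_ground, ← M.ground_finite.coe_toFinset, ← coe_finRk]
  exact_mod_cast hcon

theorem RankConnected.rank_singleton_of_pos {E : Finset α} {ρ : Finset α → ℕ} {e : α}
    (h : IsRankFn ρ) (hE : RankConnected E ρ) (hpos : 1 ≤ ρ E) (he : e ∈ E) : ρ {e} = 1 := by
  rcases Nat.lt_or_ge E.card 2 with hcard | hcard
  · obtain ⟨f, rfl⟩ : ∃ e, E = {e} := by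
      rw [← Finset.card_eq_one]
      have := hE.1.card_pos
      omega
    obtain rfl := Finset.mem_singleton.1 he
    have := h.singleton_le e
    omega
  · exact (hE.rank_singleton h hcard he).1

end Rank

/-! ### Whitney's broken circuit theorem -/

variable {α : Type*} [LinearOrder α] {M : Matroid α} {A : Finset α} {e e' : α}

/-- The witness e is spanned by larger elements of A and need not lie in A, so adding or removing it
preserves the criterion. -/
theorem not_mem_brokenCircuitComplex_iff (hA : (A : Set α) ⊆ M.E) :
    A ∉ brokenCircuitComplex M ↔ ∃ e, e ∈ M.closure (A.filter (e < ·)) := by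
  have h1 : A ∉ brokenCircuitComplex M ↔ ∃ D, IsBrokenCircuit M D ∧ D ⊆ (A : Set α) := by
    simp [brokenCircuitComplex, hA]
  rw [h1]
  constructor
  · rintro ⟨D, ⟨C, e, hC, he, rfl⟩, hDA⟩
    refine ⟨e, M.closure_subset_closure ?_ (hC.mem_closure_sdiff_singleton_of_mem he.1)⟩
    intro x hx
    rw [Finset.coe_filter]
    exact ⟨hDA hx, lt_of_le_of_ne (he.2 hx.1) (Ne.symm hx.2)⟩
  · rintro ⟨e, he⟩
    obtain ⟨C, hC, hCc, heC⟩ := Matroid.exists_isCircuit_of_mem_closure he (by simp)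
    refine ⟨C \ {e}, ⟨C, e, hCc, ⟨heC, fun x hx => ?_⟩, rfl⟩, fun x hx => ?_⟩
    · rcases hC hx with h | h
      · exact h.ge
      · exact (Finset.mem_filter.1 h).2.le
    · rcases hC hx.1 with h | h
      · exact absurd h hx.2
      · exact (Finset.mem_filter.1 h).1

theorem finRk_eq_card (hA : A ∈ brokenCircuitComplex M) : finRk M A = A.card := by
  have hind : M.Indep A := by
    rw [Matroid.indep_iff_forall_subset_not_isCircuit hA.1]
    intro C hCA hC
    have hfin : C.Finite := A.finite_toSet.subset hCA
    obtain ⟨e, he⟩ := hfin.exists_minimal hC.nonempty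
    exact hA.2 (C \ {e}) ⟨C, e, hC, ⟨he.1, fun x hx => (le_total e x).elim id (he.2 hx)⟩, rfl⟩
      (Set.sdiff_subset.trans hCA)
  rw [finRk, hind.eRk_eq_encard, Set.encard_coe_eq_coe_finsetCard, ENat.toNat_natCast]

/-- Add `e` to `A` if it is not there, and remove it otherwise. -/
def toggle (e : α) (A : Finset α) : Finset α := if e ∈ A then A.erase e else insert e A

theorem toggle_toggle (e : α) (A : Finset α) : toggle e (toggle e A) = A := by
  unfold toggle; split_ifs <;> simp_all

theorem toggle_ne (e : α) (A : Finset α) : toggle e A ≠ A := by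
  unfold toggle; split_ifs <;> simp_all

theorem neg_one_pow_card_toggle (e : α) (A : Finset α) :
    (-1 : ℤ) ^ (toggle e A).card = -(-1) ^ A.card := by
  unfold toggle
  split_ifs with h
  · rw [← Finset.card_erase_add_one h, pow_succ]; ring
  · rw [Finset.card_insert_of_notMem h, pow_succ]; ring

theorem filter_toggle (h : e ≤ e') : (toggle e A).filter (e' < ·) = A.filter (e' < ·) := by
  unfold toggle
  ext x
  split_ifs <;> simp only [Finset.mem_filter, Finset.mem_erase, Finset.mem_insert] <;> grind

theorem finRk_toggle (he : e ∈ M.closure (A.filter (e < ·))) :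
    finRk M (toggle e A) = finRk M A := by
  have key : ∀ B : Finset α, e ∈ M.closure B → finRk M (insert e B) = finRk M B := by
    intro B hB
    rw [finRk, finRk, Finset.coe_insert, ← M.eRk_closure_eq,
      Matroid.closure_insert_eq_of_mem_closure hB, M.eRk_closure_eq]
  unfold toggle
  split_ifs with h
  · conv_rhs => rw [← Finset.insert_erase h]
    refine (key _ (M.closure_subset_closure (Finset.coe_subset.2 ?_) he)).symm
    intro x hx
    rw [Finset.mem_filter] at hx
    exact Finset.mem_erase.2 ⟨hx.2.ne', hx.1⟩
  · exact key _ (M.closure_subset_closure (Finset.coe_subset.2 (Finset.filter_subset _ _)) he)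

theorem mem_ground_of_mem_closure {α : Type*} {M : Matroid α} {e : α} [M.Finite] {S : Set α} (he : e ∈ M.closure S) :
    e ∈ M.ground_finite.toFinset := by
  simpa using M.closure_subset_ground S he

open scoped Classical in
/-- Whitney's broken circuit theorem: in an alternating sum over all subsets of a function of the
rank, only the faces of the broken circuit complex contribute. -/
theorem sum_powerset_eq_sum_brokenCircuitComplex [M.Finite] (F : ℕ → ℤ) :
    ∑ A ∈ M.ground_finite.toFinset.powerset, (-1) ^ A.card * F (finRk M A) =
      ∑ A ∈ M.ground_finite.toFinset.powerset with A ∈ brokenCircuitComplex M,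
        (-1) ^ A.card * F A.card := by
  set E := M.ground_finite.toFinset with hEdef
  rw [← Finset.sum_filter_add_sum_filter_not _ (fun A => A ∈ brokenCircuitComplex M)]
  have hnot : ∑ A ∈ E.powerset with A ∉ brokenCircuitComplex M,
      (-1) ^ A.card * F (finRk M A) = 0 := by
    have hsub : ∀ A ∈ E.powerset, (A : Set α) ⊆ M.E := fun A hA => by
      simpa [hEdef] using Finset.coe_subset.2 (Finset.mem_powerset.1 hA)
    -- Toggling uses the largest witness, so that the choice survives the toggle: elements above it
    -- are untouched.
    have hmax : ∀ A ∈ E.powerset.filter (· ∉ brokenCircuitComplex M),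
        ∃ e ∈ E, e ∈ M.closure (A.filter (e < ·)) ∧
          ∀ e', e' ∈ M.closure (A.filter (e' < ·)) → e' ≤ e := by
      intro A hA
      rw [Finset.mem_filter] at hA
      obtain ⟨e, he⟩ := (not_mem_brokenCircuitComplex_iff (hsub A hA.1)).1 hA.2
      have hne : (E.filter fun e => e ∈ M.closure (A.filter (e < ·))).Nonempty :=
        ⟨e, Finset.mem_filter.2 ⟨mem_ground_of_mem_closure he, he⟩⟩
      obtain ⟨m, hm, hle⟩ := Finset.exists_max_image _ id hne
      rw [Finset.mem_filter] at hm
      exact ⟨m, hm.1, hm.2, fun e' he' =>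
        hle e' (Finset.mem_filter.2 ⟨mem_ground_of_mem_closure he', he'⟩)⟩
    obtain hempty | ⟨A, hA⟩ := (E.powerset.filter (· ∉ brokenCircuitComplex M)).eq_empty_or_nonempty
    · rw [hempty, Finset.sum_empty]
    have : Nonempty α := ⟨(hmax A hA).choose⟩
    choose! m hmE hm hmle using hmax
    have htog : ∀ A ∈ E.powerset.filter (· ∉ brokenCircuitComplex M),
        toggle (m A) A ∈ E.powerset.filter (· ∉ brokenCircuitComplex M) := by
      intro A hA
      have hAE : toggle (m A) A ∈ E.powerset := by
        have hAE := Finset.mem_powerset.1 (Finset.mem_filter.1 hA).1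
        rw [Finset.mem_powerset, toggle]
        split_ifs
        · exact (Finset.erase_subset _ _).trans hAE
        · exact Finset.insert_subset (hmE A hA) hAE
      refine Finset.mem_filter.2 ⟨hAE, (not_mem_brokenCircuitComplex_iff (hsub _ hAE)).2
        ⟨m A, ?_⟩⟩
      rw [filter_toggle le_rfl]
      exact hm A hA
    refine Finset.sum_involution (fun A _ => toggle (m A) A) ?_ ?_ htog ?_
    · intro A hA
      rw [finRk_toggle (hm A hA), neg_one_pow_card_toggle]
      ring
    · exact fun A _ _ => toggle_ne _ _
    · intro A hA
      have h1 : m (toggle (m A) A) = m A := by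
        have hle : m A ≤ m (toggle (m A) A) :=
          hmle _ (htog A hA) _ (by rw [filter_toggle le_rfl]; exact hm A hA)
        refine le_antisymm (hmle A hA _ ?_) hle
        have := hm _ (htog A hA)
        rwa [filter_toggle hle] at this
      simp only [h1, toggle_toggle]
  rw [hnot, add_zero]
  exact Finset.sum_congr rfl fun A hA => by rw [finRk_eq_card (Finset.mem_filter.1 hA).2]

/-! ### Dimension and h-vector of the broken circuit complex -/

theorem finRk_ground {α : Type*} {M : Matroid α} [M.Finite] {r : ℕ} (hr : M.eRank = (r : ℕ∞)) :
    finRk M M.ground_finite.toFinset = r := by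
  simp [finRk, M.eRk_ground, hr]

/-- The greedy basis, built from the smallest element up, omits the maximum of every circuit.
Without loops that maximum lies in the broken circuit. -/
theorem exists_mem_brokenCircuitComplex_card [M.Finite] (hl : ∀ e ∈ M.E, M.eRk {e} = 1) {r : ℕ}
    (hr : M.eRank = (r : ℕ∞)) : ∃ A ∈ brokenCircuitComplex M, A.card = r := by
  classical
  set E := M.ground_finite.toFinset
  have hE : ∀ {x}, x ∈ E ↔ x ∈ M.E := by simp [E]
  set B := E.filter fun e => e ∉ M.closure (E.filter (· < e)) with hBdef
  have hBE : (B : Set α) ⊆ M.E := fun x hx => hE.1 (Finset.mem_filter.1 hx).1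
  have hB : B ∈ brokenCircuitComplex M := by
    refine ⟨hBE, ?_⟩
    rintro D ⟨C, e, hC, he, rfl⟩ hDB
    have hfin : C.Finite := M.ground_finite.subset hC.subset_ground
    obtain ⟨m, hm⟩ := hfin.exists_maximal hC.nonempty
    have hle : ∀ x ∈ C, x ≤ m := fun x hx => (le_total x m).elim id (hm.2 hx)
    have hme : m ≠ e := by
      rintro rfl
      have hCm : C = {m} :=
        Set.eq_singleton_iff_unique_mem.2 ⟨hm.1, fun x hx => le_antisymm (hle x hx) (he.2 hx)⟩
      have h1 := hC.eRk_add_one_eq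
      rw [hCm, hl m (hC.subset_ground hm.1), Set.encard_singleton] at h1
      exact absurd h1 (by decide)
    have hmB := (Finset.mem_filter.1 (hDB ⟨hm.1, hme⟩)).2
    refine hmB (M.closure_subset_closure ?_ (hC.mem_closure_sdiff_singleton_of_mem hm.1))
    intro x hx
    rw [Finset.coe_filter]
    exact ⟨hE.2 (hC.subset_ground hx.1), lt_of_le_of_ne (hle x hx.1) hx.2⟩
  refine ⟨B, hB, ?_⟩
  have hcl : M.E ⊆ M.closure B := by
    by_contra hcon
    obtain ⟨x, hx, hxB⟩ := Set.not_subset.1 hcon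
    obtain ⟨e, he⟩ := (M.ground_finite.subset Set.sdiff_subset).exists_minimal
      (⟨x, hx, hxB⟩ : (M.E \ M.closure B).Nonempty)
    have heB : e ∉ B := fun h => he.1.2 (M.subset_closure B hBE h)
    have h1 : e ∈ M.closure (E.filter (· < e)) := by
      by_contra h
      exact heB (Finset.mem_filter.2 ⟨hE.2 he.1.1, h⟩)
    refine he.1.2 (M.closure_subset_closure_of_subset_closure ?_ h1)
    intro y hy
    rw [Finset.coe_filter] at hy
    by_contra hyB
    exact absurd (he.2 ⟨hE.1 hy.1, hyB⟩ hy.2.le) (not_le.2 hy.2)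
  rw [← finRk_eq_card hB, finRk, ← M.eRk_closure_eq, M.eRk_eq_eRank hcl, hr, ENat.toNat_natCast]

theorem dimSucc_brokenCircuitComplex [M.Finite] (hl : ∀ e ∈ M.E, M.eRk {e} = 1) {r : ℕ}
    (hr : M.eRank = (r : ℕ∞)) : dimSucc (brokenCircuitComplex M) = r := by
  refine IsGreatest.csSup_eq ⟨exists_mem_brokenCircuitComplex_card hl hr, ?_⟩
  rintro k ⟨A, hA, rfl⟩
  rw [← finRk_eq_card hA, ← finRk_ground hr]
  exact (isRankFn_finRk M).mono fun x hx => by simpa using hA.1 hx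

open scoped Classical in
theorem fNum_brokenCircuitComplex [M.Finite] (j : ℕ) :
    fNum (brokenCircuitComplex M) j =
      ((M.ground_finite.toFinset.powerset.filter (· ∈ brokenCircuitComplex M)).filter
        (·.card = j)).card := by
  rw [fNum, ← Set.ncard_coe_finset]
  congr 1
  ext A
  simp only [Finset.coe_filter, Finset.mem_filter, Finset.mem_powerset, Set.mem_ofPred_eq]
  exact ⟨fun h => ⟨⟨fun x hx => by simpa using h.1.1 hx, h.1⟩, h.2⟩, fun h => ⟨h.1.2, h.2⟩⟩

theorem coeff_X_sub_one_pow (k i : ℕ) :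
    ((X - 1 : ℤ[X]) ^ k).coeff i = (-1) ^ (k - i) * (k.choose i : ℤ) := by
  rw [sub_eq_add_neg, ← C_1, ← C_neg, coeff_X_add_C_pow]

theorem bNum_eq_coeff [M.Finite] (hl : ∀ e ∈ M.E, M.eRk {e} = 1) {r : ℕ}
    (hr : M.eRank = (r : ℕ∞)) {i : ℕ} (hi : i ≤ r) :
    bNum M i = (tutteX M.ground_finite.toFinset (finRk M)).coeff i := by
  classical
  have hrk := finRk_ground hr
  have hT : (tutteX M.ground_finite.toFinset (finRk M)).coeff i =
      ∑ A ∈ M.ground_finite.toFinset.powerset, (-1) ^ A.card *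
        ((-1) ^ finRk M A * ((-1) ^ (r - finRk M A - i) * ((r - finRk M A).choose i : ℤ))) := by
    rw [tutteX, finsetSum_coeff]
    refine Finset.sum_congr rfl fun A _ => ?_
    rw [hrk, ← coeff_X_sub_one_pow, ← mul_assoc, ← pow_add,
      show ((-1 : ℤ[X]) ^ (A.card + finRk M A)) = C ((-1) ^ (A.card + finRk M A)) by simp,
      coeff_C_mul]
  rw [hT, sum_powerset_eq_sum_brokenCircuitComplex
    fun k => (-1) ^ k * ((-1) ^ (r - k - i) * ((r - k).choose i : ℤ))]
  rw [bNum, hr, ENat.toNat_natCast, if_pos hi, hNum, dimSucc_brokenCircuitComplex hl hr,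
    if_pos (Nat.sub_le r i)]
  set Δ := M.ground_finite.toFinset.powerset.filter (· ∈ brokenCircuitComplex M)
  have hsum : ∀ A ∈ Δ, (-1 : ℤ) ^ A.card *
      ((-1) ^ A.card * ((-1) ^ (r - A.card - i) * ((r - A.card).choose i : ℤ))) =
      ∑ j ∈ Finset.range (r - i + 1), if A.card = j then
        (-1 : ℤ) ^ (r - i - j) * ((r - j).choose (r - (r - i)) : ℤ) else 0 := by
    intro A hA
    have hAr : A.card ≤ r := by
      rw [← finRk_eq_card (Finset.mem_filter.1 hA).2, ← hrk]
      exact (isRankFn_finRk M).mono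
        (Finset.mem_powerset.1 (Finset.mem_filter.1 hA).1)
    -- On faces rank equals cardinality, so the signs cancel. Faces with more than r - i elements
    -- contribute a zero binomial coefficient.
    rw [← mul_assoc, ← pow_add, Even.neg_one_pow ⟨_, rfl⟩, one_mul, Finset.sum_ite_eq,
      Nat.sub_sub_self hi, Nat.sub_right_comm]
    split_ifs with h
    · rfl
    · rw [Finset.mem_range] at h
      rw [Nat.choose_eq_zero_of_lt (by omega)]
      simp
  rw [Finset.sum_congr rfl hsum, Finset.sum_comm]
  refine Finset.sum_congr rfl fun j _ => ?_
  rw [fNum_brokenCircuitComplex, ← Finset.sum_filter, Finset.sum_const, nsmul_eq_mul, mul_comm]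

theorem coeff_bound (r i : ℕ) (β : ℤ) :
    (X * (1 + X) ^ r * (C β + X) : ℤ[X]).coeff (i + 2) =
      (r.choose (i + 1) : ℤ) * β + (r.choose i : ℤ) := by
  rw [mul_assoc, coeff_X_mul, mul_add, coeff_add, coeff_mul_C, coeff_mul_X,
    coeff_one_add_X_pow, coeff_one_add_X_pow]

end BrokenCircuit

theorem mainTheorem1 {α : Type*} [LinearOrder α] (M : Matroid α) [M.Finite]
    (hM : BrokenCircuit.IsConnected M) (r : ℕ) (hr : M.eRank = (r : ℕ∞))
    (i : ℕ) (hi1 : 1 ≤ i) (hir : i ≤ r) :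
    BrokenCircuit.bNum M i ≤
      BrokenCircuit.intBinom ((r : ℤ) - 2) ((i : ℤ) - 1) * BrokenCircuit.bNum M 1
        + BrokenCircuit.intBinom ((r : ℤ) - 2) ((i : ℤ) - 2) := by
  open BrokenCircuit in
  obtain ⟨i, rfl⟩ : ∃ k, i = k + 1 := ⟨i - 1, by omega⟩
  rcases i with _ | i
  -- For i = 1 equality holds. Rank 1, with upper index -1, occurs only here; afterwards i ≥ 2
  -- forces r ≥ 2.
  · simp [intBinom]
  obtain ⟨r, rfl⟩ : ∃ k, r = k + 2 := ⟨r - 2, by omega⟩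
  have hE := hM.rankConnected
  have hρ := isRankFn_finRk M
  have hrk := finRk_ground hr
  have hl : ∀ e ∈ M.E, M.eRk {e} = 1 := fun e he => by
    have := hE.rank_singleton_of_pos hρ (by omega) (e := e) (by simpa using he)
    rw [← Finset.coe_singleton, ← coe_finRk, this, Nat.cast_one]
  obtain ⟨-, -, hb⟩ := RankConnected.tutteX_le _ _ _ rfl hρ hE (by omega)
  have hb := hb r hrk (i + 2)
  rw [Polynomial.coeff_sub, coeff_bound, ← bNum_eq_coeff hl hr (by omega),
    ← bNum_eq_coeff hl hr hir] at hb
  have e1 : ((r + 2 : ℕ) : ℤ) - 2 = (r : ℕ) := by push_cast; ring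
  have e2 : ((i + 1 + 1 : ℕ) : ℤ) - 1 = ((i + 1 : ℕ) : ℤ) := by push_cast; ring
  have e3 : ((i + 1 + 1 : ℕ) : ℤ) - 2 = (i : ℕ) := by push_cast; ring
  rw [e1, e2, e3]
  simp only [intBinom, Nat.cast_nonneg, if_true, Int.toNat_natCast, Ring.choose_natCast]
  linarith
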